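/- Let $n\in\mathbb N$, let $\mathbb B_n=\{z\in\mathbb C^n:|z|<1\}$ be the open unit ball for the Euclidean norm, and write $\langle z,w\rangle=\sum_{k=1}^n z_k\overline{w_k}$. For a holomorphic function $f:\mathbb B_n\to\mathbb C$ let $\nabla f=(\partial f/\partial z_1,\dots,\partial f/\partial z_n)$ be its complex gradient. For $p\in(0,1)$ let $\mathcal L_p(\mathbb B_n)$ be the space of all holomorphic $f:\mathbb B_n\to\mathbb C$ for which there is a $C>0$ with $|f(z)-f(w)|\le C|z-w|^p$ for all $z,w\in\mathbb B_n$, with the norm $$\|f\|_{\mathcal L_p}=|f(0)|+\sup_{z,w\in\mathbb B_n,\ z\neq w}\frac{|f(z)-f(w)|}{|z-w|^p}.$$ Let $p,q\in(0,1)$, let $\phi=(\phi_1,\dots,\phi_n):\mathbb B_n\to\mathbb B_n$ be holomorphic, and let $C_\phi f=f\circ\phi$. Then the following hold. (A) If there is an $M\ge 0$ such that $$\frac{(1-|z|^2)^{1-q}}{(1-|\phi(z)|^2)^{1-p}}\,|\nabla\phi_j(z)|\le M\quad\text{for all } j\in\{1,\dots,n\}\text{ and } z\in\mathbb B_n,$$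 then $C_\phi$ is a bounded operator from $\mathcal L_p(\mathbb B_n)$ to $\mathcal L_q(\mathbb B_n)$, that is, it maps $\mathcal L_p(\mathbb B_n)$ into $\mathcal L_q(\mathbb B_n)$ and there is a $C\ge 0$ with $\|f\circ\phi\|_{\mathcal L_q}\le C\|f\|_{\mathcal L_p}$ for all $f\in\mathcal L_p(\mathbb B_n)$. (B) If $C_\phi$ is a bounded operator from $\mathcal L_p(\mathbb B_n)$ to $\mathcal L_q(\mathbb B_n)$, then there is an $M'\ge 0$ such that for all $z\in\mathbb B_n$ and all $u\in\partial\mathbb B_n$, $$\frac{(1-|z|^2)^{1-q}}{(1-|\langle\phi(z),u\rangle|^2)^{1-p}}\,\bigl|\nabla\langle\phi(\cdot),u\rangle(z)\bigr|\le M'.$$ -/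

import Mathlib

noncomputable section

namespace LipschitzBall

/-- The open unit ball of `ℂⁿ` with its Euclidean norm. -/
def unitBall (n : ℕ) : Set (EuclideanSpace ℂ (Fin n)) := Metric.ball 0 1

/-- The complex gradient `∇f(z) = (D₁f(z), …, Dₙf(z))`, where `D_j f(z)` is the complex directional
derivative `lim_{t → 0} (f (z + t e_j) - f z) / t` along the standard basis vector `e_j`. -/
def grad {n : ℕ} (f : EuclideanSpace ℂ (Fin n) → ℂ) (z : EuclideanSpace ℂ (Fin n)) :
    EuclideanSpace ℂ (Fin n) :=
  WithLp.toLp 2 fun j => lineDeriv ℂ f z (EuclideanSpace.single j 1)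

/-- `f` (only its values on the ball matter) belongs to the holomorphic `p`-Lipschitz space of the
unit ball. -/
def MemLip {n : ℕ} (p : ℝ) (f : EuclideanSpace ℂ (Fin n) → ℂ) : Prop :=
  DifferentiableOn ℂ f (unitBall n) ∧
    ∃ C : ℝ, 0 < C ∧ ∀ z ∈ unitBall n, ∀ w ∈ unitBall n, ‖f z - f w‖ ≤ C * ‖z - w‖ ^ p

/-- The Lipschitz constant of `f`: the supremum of the Hölder quotients of exponent `p` over the
ball. It is used only for members of the `p`-Lipschitz space, where the set is bounded. -/
def lipConst {n : ℕ} (p : ℝ) (f : EuclideanSpace ℂ (Fin n) → ℂ) : ℝ :=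
  sSup {r : ℝ | ∃ z ∈ unitBall n, ∃ w ∈ unitBall n, z ≠ w ∧ r = ‖f z - f w‖ / ‖z - w‖ ^ p}

/-- The norm `|f(0)| + (Lipschitz constant of f)` of the holomorphic `p`-Lipschitz space. -/
def lipNorm {n : ℕ} (p : ℝ) (f : EuclideanSpace ℂ (Fin n) → ℂ) : ℝ :=
  ‖f 0‖ + lipConst p f

/-- The composition operator `f ↦ f ∘ φ` is a bounded operator from the `p`-Lipschitz space to the
`q`-Lipschitz space: it maps the former into the latter and its norm there is finite. -/
def IsBoundedComp {n : ℕ} (p q : ℝ)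
    (φ : EuclideanSpace ℂ (Fin n) → EuclideanSpace ℂ (Fin n)) : Prop :=
  ∃ C : ℝ, 0 ≤ C ∧ ∀ f : EuclideanSpace ℂ (Fin n) → ℂ, MemLip p f →
    MemLip q (f ∘ φ) ∧ lipNorm q (f ∘ φ) ≤ C * lipNorm p f

end LipschitzBall

end

/-! A holomorphic function on the ball is Hölder of exponent `p` exactly when its derivative is O((1
- |z|²)^(p-1)): Cauchy's estimate gives one direction (`norm_fderiv_le_of_holder`), integration
along radii the other (`norm_sub_le_of_norm_fderiv_le`). Both constants are explicit, so norm bounds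
transfer. (A) By the chain rule the derivative of f ∘ φ is at most a constant times (1 -
|φ(z)|²)^(p-1) |φ'(z)|, which the hypothesis turns into O((1 - |z|²)^(q-1)). (B) The functions (1 -
c⟨w,u⟩)^p have norms bounded uniformly in unimodular c and unit u. For given z and u, choose c so
that c⟨φ(z),u⟩ = |⟨φ(z),u⟩|; Cauchy's estimate for the composite at z is then the required bound. -/

namespace LipschitzBall

open Metric Set

/-! ### Hölder continuity and growth of the derivative -/

section Normed

variable {E : Type*} [NormedAddCommGroup E] [NormedSpace ℂ E]

/-- Cauchy's estimate: a holomorphic Hölder function on the unit ball has a derivative which grows at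
most like `(1 - ‖z‖²)^(p - 1)`. -/
theorem norm_fderiv_le_of_holder {p L : ℝ} (hL : 0 ≤ L) {f : E → ℂ}
    (hf : DifferentiableOn ℂ f (ball 0 1))
    (h : ∀ z ∈ ball (0 : E) 1, ∀ w ∈ ball (0 : E) 1, ‖f z - f w‖ ≤ L * ‖z - w‖ ^ p)
    {z : E} (hz : z ∈ ball (0 : E) 1) :
    ‖fderiv ℂ f z‖ ≤ L * ((1 - ‖z‖ ^ 2) / 4) ^ (p - 1) := by
  have hz1 : ‖z‖ < 1 := by simpa using hz
  have hz0 := norm_nonneg z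
  -- As 1 - ‖z‖² ≤ 2(1 - ‖z‖), this radius is at most half the distance to the sphere.
  set r := (1 - ‖z‖ ^ 2) / 4 with hr
  have hr0 : 0 < r := by rw [hr]; nlinarith
  have hzr : ‖z‖ + r < 1 := by rw [hr]; nlinarith
  refine ContinuousLinearMap.opNorm_le_bound _ (by positivity) fun v => ?_
  rcases eq_or_ne v 0 with rfl | hv
  · simp
  have hv0 : 0 < ‖v‖ := norm_pos_iff.2 hv
  have hmem : ∀ t : ℂ, ‖t‖ ≤ r / ‖v‖ → z + t • v ∈ ball (0 : E) 1 := by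
    intro t ht
    have : ‖t‖ * ‖v‖ ≤ r := (le_div_iff₀ hv0).1 ht
    rw [mem_ball_zero_iff]
    calc ‖z + t • v‖ ≤ ‖z‖ + ‖t • v‖ := norm_add_le _ _
      _ = ‖z‖ + ‖t‖ * ‖v‖ := by rw [norm_smul]
      _ < 1 := by linarith
  have hdf : ∀ y ∈ ball (0 : E) 1, DifferentiableAt ℂ f y := fun y hy =>
    hf.differentiableAt (isOpen_ball.mem_nhds hy)
  have hline : ∀ t : ℂ, HasDerivAt (fun t : ℂ => z + t • v) v t := fun t => by
    simpa using ((hasDerivAt_id t).smul_const v).const_add z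
  -- Subtracting the constant f z makes the slice at most L r^p on the circle.
  have hd : ∀ t : ℂ, ‖t‖ ≤ r / ‖v‖ →
      HasDerivAt (fun t : ℂ => f (z + t • v) - f z) (fderiv ℂ f (z + t • v) v) t := fun t ht =>
    ((hdf _ (hmem t ht)).hasFDerivAt.comp_hasDerivAt t (hline t)).sub_const _
  have hR : 0 < r / ‖v‖ := by positivity
  have hcl : DiffContOnCl ℂ (fun t : ℂ => f (z + t • v) - f z) (ball 0 (r / ‖v‖)) := by
    refine DifferentiableOn.diffContOnCl fun t ht => ?_
    have ht' := closure_ball_subset_closedBall ht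
    exact (hd t (by simpa using ht')).differentiableAt.differentiableWithinAt
  have key := Complex.norm_deriv_le_of_forall_mem_sphere_norm_le (C := L * r ^ p) hR hcl (by
    intro t ht
    have ht' : ‖t‖ = r / ‖v‖ := by simpa using ht
    have := h _ (hmem t ht'.le) z hz
    rwa [add_sub_cancel_left, norm_smul, ht', div_mul_cancel₀ _ hv0.ne'] at this)
  rw [(hd 0 (by simpa using hR.le)).deriv] at key
  simp only [zero_smul, add_zero] at key
  calc ‖fderiv ℂ f z v‖ ≤ L * r ^ p / (r / ‖v‖) := key
    _ = L * r ^ (p - 1) * ‖v‖ := by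
      rw [Real.rpow_sub_one hr0.ne']; field_simp

/-- The radial part of the Hardy–Littlewood estimate. -/
theorem norm_sub_radial_le {q K : ℝ} (hK : 0 ≤ K) (hq : q ∈ Ioo (0 : ℝ) 1) {g : E → ℂ}
    (hg : DifferentiableOn ℂ g (ball 0 1))
    (h : ∀ z ∈ ball (0 : E) 1, ‖fderiv ℂ g z‖ ≤ K * (1 - ‖z‖ ^ 2) ^ (q - 1))
    {z : E} (hz : z ∈ ball (0 : E) 1) {d : ℝ} (hd : d ∈ Icc (0 : ℝ) 1) :
    ‖g (((1 - d : ℝ) : ℂ) • z) - g z‖ ≤ K / q * d ^ q := by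
  obtain ⟨hq0, hq1⟩ := hq
  have hz1 : ‖z‖ < 1 := by simpa using hz
  have hz0 := norm_nonneg z
  have hnorm : ∀ s ∈ Icc 0 d, ‖((1 - s : ℝ) : ℂ) • z‖ = (1 - s) * ‖z‖ := fun s hs => by
    rw [norm_smul, Complex.norm_real, Real.norm_of_nonneg (by linarith [hs.2, hd.2])]
  have hmem : ∀ s ∈ Icc 0 d, ((1 - s : ℝ) : ℂ) • z ∈ ball (0 : E) 1 := fun s hs => by
    rw [mem_ball_zero_iff, hnorm s hs]; nlinarith [hs.1, hs.2, hd.2]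
  have hderiv : ∀ s ∈ Icc 0 d, HasDerivAt (fun s : ℝ => g (((1 - s : ℝ) : ℂ) • z) - g z)
      (fderiv ℂ g (((1 - s : ℝ) : ℂ) • z) (-z)) s := fun s hs => by
    have h1 : HasDerivAt (fun s : ℝ => ((1 - s : ℝ) : ℂ)) (-1 : ℂ) s := by
      simpa using ((hasDerivAt_id s).const_sub 1).ofReal_comp
    have h2 : HasDerivAt (fun s : ℝ => ((1 - s : ℝ) : ℂ) • z) (-z) s := by
      simpa using h1.smul_const z
    have h3 := (hg.differentiableAt (isOpen_ball.mem_nhds (hmem s hs))).hasFDerivAt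
    exact ((h3.restrictScalars ℝ).comp_hasDerivAt s h2).sub_const _
  have hpos : ∀ s ∈ Icc 0 d, 0 < 1 - ‖z‖ + s * ‖z‖ := fun s hs => by nlinarith [hs.1]
  -- A primitive of K (1 - ‖x‖)^(q-1) ‖z‖ along x = (1 - s)z; it dominates because 1 - ‖x‖ ≤ 1 -
  -- ‖x‖² and q < 1.
  have hB : ∀ s ∈ Icc 0 d, HasDerivAt
      (fun s : ℝ => K / q * ((1 - ‖z‖ + s * ‖z‖) ^ q - (1 - ‖z‖) ^ q))
      (K * (1 - ‖z‖ + s * ‖z‖) ^ (q - 1) * ‖z‖) s := fun s hs => by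
    have h1 : HasDerivAt (fun s : ℝ => 1 - ‖z‖ + s * ‖z‖) ‖z‖ s := by
      simpa using ((hasDerivAt_id s).mul_const ‖z‖).const_add (1 - ‖z‖)
    have h2 := ((h1.rpow_const (p := q) (Or.inl (hpos s hs).ne')).sub_const
      ((1 - ‖z‖) ^ q)).const_mul (K / q)
    refine h2.congr_deriv ?_
    have := hq0.ne'
    field_simp
  have key := image_norm_le_of_norm_deriv_right_le_deriv_boundary'
    (f := fun s : ℝ => g (((1 - s : ℝ) : ℂ) • z) - g z) (a := 0) (b := d)
    (fun s hs => (hderiv s hs).continuousAt.continuousWithinAt)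
    (fun s hs => (hderiv s (Ico_subset_Icc_self hs)).hasDerivWithinAt)
    (by simp)
    (fun s hs => (hB s hs).continuousAt.continuousWithinAt)
    (fun s hs => (hB s (Ico_subset_Icc_self hs)).hasDerivWithinAt)
    (by
      intro s hs'
      have hs := Ico_subset_Icc_self hs'
      refine (ContinuousLinearMap.le_opNorm _ _).trans ?_
      rw [norm_neg]
      refine mul_le_mul_of_nonneg_right ((h _ (hmem s hs)).trans ?_) hz0
      refine mul_le_mul_of_nonneg_left ?_ hK
      refine Real.rpow_le_rpow_of_nonpos (hpos s hs) ?_ (by linarith)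
      rw [hnorm s hs]
      have : (1 - s) * ‖z‖ < 1 := by nlinarith [hs.1, hs.2, hd.2]
      have h0 : 0 ≤ (1 - s) * ‖z‖ := mul_nonneg (by linarith [hs.2, hd.2]) hz0
      nlinarith)
    (right_mem_Icc.2 hd.1)
  refine key.trans (mul_le_mul_of_nonneg_left ?_ (by positivity))
  -- Subadditivity of t ↦ t^q makes the bound independent of ‖z‖.
  have h1 := Real.rpow_add_le_add_rpow (p := q) (by linarith : 0 ≤ 1 - ‖z‖)
    (mul_nonneg hd.1 hz0) hq0.le hq1.le
  have h2 : (d * ‖z‖) ^ q ≤ d ^ q := Real.rpow_le_rpow (mul_nonneg hd.1 hz0)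
    (by nlinarith [hd.1]) hq0.le
  linarith

/-- The Hardy–Littlewood theorem: a holomorphic function on the unit ball whose derivative grows at
most like `(1 - ‖z‖²)^(q - 1)` is Hölder continuous with exponent `q`. -/
theorem norm_sub_le_of_norm_fderiv_le {q K : ℝ} (hK : 0 ≤ K) (hq : q ∈ Ioo (0 : ℝ) 1) {g : E → ℂ}
    (hg : DifferentiableOn ℂ g (ball 0 1))
    (h : ∀ z ∈ ball (0 : E) 1, ‖fderiv ℂ g z‖ ≤ K * (1 - ‖z‖ ^ 2) ^ (q - 1))
    {z w : E} (hz : z ∈ ball (0 : E) 1) (hw : w ∈ ball (0 : E) 1) :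
    ‖g z - g w‖ ≤ K * (1 + 2 / q) * ‖z - w‖ ^ q := by
  have hq0 := hq.1
  rcases eq_or_ne z w with rfl | hzw
  · simp [Real.zero_rpow hq0.ne']
  have hD : 0 < ‖z - w‖ := norm_pos_iff.2 (sub_ne_zero.2 hzw)
  -- Both points are pulled in by the factor 1 - d, to where the derivative is at most K d^(q-1).
  -- The cap at 1 keeps the factor nonnegative, since ‖z - w‖ can approach 2.
  set d := min ‖z - w‖ 1 with hdef
  have hd0 : 0 < d := lt_min hD one_pos
  have hd1 : d ≤ 1 := min_le_right _ _
  have hdD : d ≤ ‖z - w‖ := min_le_left _ _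
  have hrz := norm_sub_radial_le hK hq hg h hz ⟨hd0.le, hd1⟩
  have hrw := norm_sub_radial_le hK hq hg h hw ⟨hd0.le, hd1⟩
  have hn : ‖((1 - d : ℝ) : ℂ)‖ = 1 - d := by
    rw [Complex.norm_real, Real.norm_of_nonneg (by linarith)]
  have hcl : ∀ x ∈ ball (0 : E) 1, ((1 - d : ℝ) : ℂ) • x ∈ closedBall (0 : E) (1 - d) := by
    intro x hx
    rw [mem_ball_zero_iff] at hx
    rw [mem_closedBall_zero_iff, norm_smul, hn]
    nlinarith
  have hmid : ‖g (((1 - d : ℝ) : ℂ) • z) - g (((1 - d : ℝ) : ℂ) • w)‖ ≤ K * d ^ q := by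
    have hsub : ∀ x ∈ closedBall (0 : E) (1 - d), x ∈ ball (0 : E) 1 := fun x hx =>
      closedBall_subset_ball (by linarith) hx
    have hmv := (convex_closedBall (0 : E) (1 - d)).norm_image_sub_le_of_norm_fderiv_le (𝕜 := ℂ)
      (f := g) (C := K * d ^ (q - 1))
      (fun x hx => hg.differentiableAt (isOpen_ball.mem_nhds (hsub x hx)))
      (fun x hx => by
        refine (h x (hsub x hx)).trans (mul_le_mul_of_nonneg_left ?_ hK)
        refine Real.rpow_le_rpow_of_nonpos hd0 ?_ (by linarith [hq.2])
        have hx' := mem_closedBall_zero_iff.1 hx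
        nlinarith [norm_nonneg x])
      (hcl w hw) (hcl z hz)
    refine hmv.trans ?_
    rw [← smul_sub, norm_smul, hn]
    have hlen : (1 - d) * ‖z - w‖ ≤ d := by
      rcases min_choice ‖z - w‖ 1 with h1 | h1
      · rw [← hdef] at h1; rw [← h1]; nlinarith
      · rw [← hdef] at h1; rw [h1]; simp
    calc K * d ^ (q - 1) * ((1 - d) * ‖z - w‖) ≤ K * d ^ (q - 1) * d := by gcongr
      _ = K * d ^ q := by rw [Real.rpow_sub_one hd0.ne']; field_simp
  have htri : ‖g z - g w‖ ≤ ‖g (((1 - d : ℝ) : ℂ) • z) - g z‖ +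
      ‖g (((1 - d : ℝ) : ℂ) • z) - g (((1 - d : ℝ) : ℂ) • w)‖ +
      ‖g (((1 - d : ℝ) : ℂ) • w) - g w‖ := by
    have e : g z - g w = -(g (((1 - d : ℝ) : ℂ) • z) - g z) +
        (g (((1 - d : ℝ) : ℂ) • z) - g (((1 - d : ℝ) : ℂ) • w)) +
        (g (((1 - d : ℝ) : ℂ) • w) - g w) := by ring
    rw [e]
    refine (norm_add₃_le).trans ?_
    rw [norm_neg]
  calc ‖g z - g w‖ ≤ K / q * d ^ q + K * d ^ q + K / q * d ^ q := by linarith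
    _ = K * (1 + 2 / q) * d ^ q := by ring
    _ ≤ K * (1 + 2 / q) * ‖z - w‖ ^ q := by gcongr

end Normed

/-! ### Complex gradients and the Hölder seminorm -/

variable {n : ℕ}

theorem grad_apply {f : EuclideanSpace ℂ (Fin n) → ℂ} {z : EuclideanSpace ℂ (Fin n)}
    (hf : DifferentiableAt ℂ f z) (j : Fin n) :
    grad f z j = fderiv ℂ f z (EuclideanSpace.single j 1) := by
  simp [grad, hf.lineDeriv_eq_fderiv]

theorem fderiv_apply_eq_sum {f : EuclideanSpace ℂ (Fin n) → ℂ} {z : EuclideanSpace ℂ (Fin n)}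
    (hf : DifferentiableAt ℂ f z) (v : EuclideanSpace ℂ (Fin n)) :
    fderiv ℂ f z v = ∑ j, v j * grad f z j := by
  have hv : v = ∑ j, v j • EuclideanSpace.single j (1 : ℂ) := by
    ext i; simp [Finset.sum_apply, Pi.single_apply]
  conv_lhs => rw [hv]
  simp [grad_apply hf]

theorem norm_grad_eq_norm_fderiv {f : EuclideanSpace ℂ (Fin n) → ℂ}
    {z : EuclideanSpace ℂ (Fin n)} (hf : DifferentiableAt ℂ f z) :
    ‖grad f z‖ = ‖fderiv ℂ f z‖ := by
  -- The Riesz vector of the derivative; conjugated because `inner` is conjugate-linear in its first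
  -- slot.
  set g : EuclideanSpace ℂ (Fin n) := WithLp.toLp 2 fun j => star (grad f z j) with hg
  have hinner : ∀ v, fderiv ℂ f z v = inner ℂ g v := fun v => by
    rw [fderiv_apply_eq_sum hf, PiLp.inner_apply]
    simp [hg]
  have hgn : ‖g‖ = ‖grad f z‖ := by simp [EuclideanSpace.norm_eq, hg]
  have hL : fderiv ℂ f z = innerSL ℂ g := by ext v; simp [hinner]
  rw [hL, innerSL_apply_norm, hgn]

theorem norm_sub_le_lipConst {p : ℝ} (hp : 0 < p) {f : EuclideanSpace ℂ (Fin n) → ℂ}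
    (hf : MemLip p f) {z w : EuclideanSpace ℂ (Fin n)} (hz : z ∈ unitBall n)
    (hw : w ∈ unitBall n) : ‖f z - f w‖ ≤ lipConst p f * ‖z - w‖ ^ p := by
  rcases eq_or_ne z w with rfl | hzw
  · simp [Real.zero_rpow hp.ne']
  obtain ⟨-, C, -, hC⟩ := hf
  have hD : 0 < ‖z - w‖ ^ p := Real.rpow_pos_of_pos (norm_pos_iff.2 (sub_ne_zero.2 hzw)) p
  rw [← div_le_iff₀ hD]
  refine le_csSup ⟨C, ?_⟩ ⟨z, hz, w, hw, hzw, rfl⟩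
  rintro r ⟨x, hx, y, hy, hxy, rfl⟩
  exact (div_le_iff₀ (Real.rpow_pos_of_pos (norm_pos_iff.2 (sub_ne_zero.2 hxy)) p)).2
    (hC x hx y hy)

theorem lipConst_nonneg (p : ℝ) (f : EuclideanSpace ℂ (Fin n) → ℂ) : 0 ≤ lipConst p f :=
  Real.sSup_nonneg (by rintro r ⟨x, -, y, -, -, rfl⟩; positivity)

theorem lipConst_le {p C : ℝ} (hC0 : 0 ≤ C) {f : EuclideanSpace ℂ (Fin n) → ℂ}
    (hC : ∀ z ∈ unitBall n, ∀ w ∈ unitBall n, ‖f z - f w‖ ≤ C * ‖z - w‖ ^ p) :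
    lipConst p f ≤ C := by
  -- For n = 0 there are no quotients and the `sSup` is 0, hence the need for 0 ≤ C.
  refine Real.sSup_le ?_ hC0
  rintro r ⟨x, hx, y, hy, hxy, rfl⟩
  exact (div_le_iff₀ (Real.rpow_pos_of_pos (norm_pos_iff.2 (sub_ne_zero.2 hxy)) p)).2
    (hC x hx y hy)

theorem memLip_of_norm_fderiv_le {q K : ℝ} (hK : 0 ≤ K) (hq : q ∈ Ioo (0 : ℝ) 1)
    {g : EuclideanSpace ℂ (Fin n) → ℂ} (hg : DifferentiableOn ℂ g (unitBall n))
    (h : ∀ z ∈ unitBall n, ‖fderiv ℂ g z‖ ≤ K * (1 - ‖z‖ ^ 2) ^ (q - 1)) :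
    MemLip q g ∧ lipConst q g ≤ K * (1 + 2 / q) := by
  have hq0 := hq.1
  have hH : ∀ z ∈ unitBall n, ∀ w ∈ unitBall n,
      ‖g z - g w‖ ≤ K * (1 + 2 / q) * ‖z - w‖ ^ q := fun z hz w hw =>
    norm_sub_le_of_norm_fderiv_le hK hq hg h hz hw
  -- `MemLip` asks for a positive constant and K may be 0, hence the + 1.
  refine ⟨⟨hg, K * (1 + 2 / q) + 1, by positivity, fun z hz w hw => (hH z hz w hw).trans ?_⟩,
    lipConst_le (by positivity) hH⟩
  gcongr
  linarith

theorem one_sub_norm_sq_pos {E : Type*} [NormedAddCommGroup E] {z : E} (hz : ‖z‖ < 1) :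
    0 < 1 - ‖z‖ ^ 2 := by
  nlinarith [norm_nonneg z]

theorem norm_lt_one_of_mem {z : EuclideanSpace ℂ (Fin n)} (hz : z ∈ unitBall n) : ‖z‖ < 1 :=
  mem_ball_zero_iff.1 hz

theorem differentiableAt_of_mem {F : Type*} [NormedAddCommGroup F] [NormedSpace ℂ F]
    {f : EuclideanSpace ℂ (Fin n) → F} (hf : DifferentiableOn ℂ f (unitBall n))
    {z : EuclideanSpace ℂ (Fin n)} (hz : z ∈ unitBall n) : DifferentiableAt ℂ f z :=
  hf.differentiableAt (isOpen_ball.mem_nhds hz)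

theorem norm_fderiv_le_sum_norm_grad {φ : EuclideanSpace ℂ (Fin n) → EuclideanSpace ℂ (Fin n)}
    {z : EuclideanSpace ℂ (Fin n)} (hφ : DifferentiableAt ℂ φ z) :
    ‖fderiv ℂ φ z‖ ≤ ∑ j, ‖grad (fun x => φ x j) z‖ := by
  refine ContinuousLinearMap.opNorm_le_bound _ (by positivity) fun v => ?_
  have hcomp : ∀ j, HasFDerivAt (fun x => φ x j)
      ((EuclideanSpace.proj j : EuclideanSpace ℂ (Fin n) →L[ℂ] ℂ).comp (fderiv ℂ φ z)) z :=
    fun j => (EuclideanSpace.proj j : EuclideanSpace ℂ (Fin n) →L[ℂ] ℂ).hasFDerivAt.comp z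
      hφ.hasFDerivAt
  have hsum : fderiv ℂ φ z v = ∑ j, EuclideanSpace.single j (fderiv ℂ φ z v j) := by
    ext i; simp [Finset.sum_apply, Pi.single_apply]
  rw [hsum, Finset.sum_mul]
  refine (norm_sum_le _ _).trans (Finset.sum_le_sum fun j _ => ?_)
  rw [norm_grad_eq_norm_fderiv (hcomp j).differentiableAt, PiLp.norm_single]
  have := (fderiv ℂ (fun x => φ x j) z).le_opNorm v
  rwa [(hcomp j).fderiv] at this ⊢

/-! ### Sufficiency: part (A) -/

theorem isBoundedComp_of_grad_le {p q : ℝ} (hp : p ∈ Ioo (0 : ℝ) 1) (hq : q ∈ Ioo (0 : ℝ) 1)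
    {φ : EuclideanSpace ℂ (Fin n) → EuclideanSpace ℂ (Fin n)}
    (hφ : DifferentiableOn ℂ φ (unitBall n)) (hmaps : MapsTo φ (unitBall n) (unitBall n))
    {M : ℝ} (hM : 0 ≤ M)
    (h : ∀ j : Fin n, ∀ z ∈ unitBall n,
      (1 - ‖z‖ ^ 2) ^ (1 - q) / (1 - ‖φ z‖ ^ 2) ^ (1 - p) * ‖grad (fun x => φ x j) z‖ ≤ M) :
    IsBoundedComp p q φ := by
  obtain ⟨hp0, hp1⟩ := hp
  have hq0 := hq.1
  have h0 : (0 : EuclideanSpace ℂ (Fin n)) ∈ unitBall n := mem_ball_self one_pos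
  -- The power of 1/4 comes from Cauchy's estimate, the n from summing over the coordinates of φ.
  set A : ℝ := (1 / 4) ^ (p - 1) * (n * M) with hA
  have hA0 : 0 ≤ A := by positivity
  -- The summand 1 pays for |f(φ(0))| ≤ |f(0)| + L.
  refine ⟨1 + A * (1 + 2 / q), by positivity, fun f hf => ?_⟩
  set L := lipConst p f with hL
  have hL0 : 0 ≤ L := lipConst_nonneg p f
  have hHf : ∀ z ∈ unitBall n, ∀ w ∈ unitBall n, ‖f z - f w‖ ≤ L * ‖z - w‖ ^ p :=
    fun z hz w hw => norm_sub_le_lipConst hp0 hf hz hw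
  have hbound : ∀ z ∈ unitBall n, ‖fderiv ℂ (f ∘ φ) z‖ ≤ L * A * (1 - ‖z‖ ^ 2) ^ (q - 1) := by
    intro z hz
    have hφz := hmaps hz
    have ha := one_sub_norm_sq_pos (norm_lt_one_of_mem hz)
    have hb := one_sub_norm_sq_pos (norm_lt_one_of_mem hφz)
    have hgr : ∀ j, ‖grad (fun x => φ x j) z‖ ≤
        M * ((1 - ‖φ z‖ ^ 2) ^ (1 - p) * (1 - ‖z‖ ^ 2) ^ (q - 1)) := fun j => by
      have hj := h j z hz
      have e : (1 - ‖z‖ ^ 2) ^ (q - 1) = ((1 - ‖z‖ ^ 2) ^ (1 - q))⁻¹ := by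
        rw [← Real.rpow_neg ha.le, neg_sub]
      have ha' := Real.rpow_pos_of_pos ha (1 - q)
      have hb' := Real.rpow_pos_of_pos hb (1 - p)
      rw [div_mul_eq_mul_div, div_le_iff₀ hb'] at hj
      rw [e, ← mul_assoc, ← div_eq_mul_inv, le_div_iff₀ ha']
      linarith
    have hDφ : ‖fderiv ℂ φ z‖ ≤
        n * M * ((1 - ‖φ z‖ ^ 2) ^ (1 - p) * (1 - ‖z‖ ^ 2) ^ (q - 1)) := by
      refine (norm_fderiv_le_sum_norm_grad (differentiableAt_of_mem hφ hz)).trans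
        ((Finset.sum_le_sum fun j _ => hgr j).trans (le_of_eq ?_))
      simp [mul_assoc]
    have hDf := norm_fderiv_le_of_holder hL0 hf.1 hHf hφz
    have hcancel : (1 - ‖φ z‖ ^ 2) ^ (p - 1) * (1 - ‖φ z‖ ^ 2) ^ (1 - p) = 1 := by
      rw [← Real.rpow_add hb]; simp
    rw [fderiv_comp z (differentiableAt_of_mem hf.1 hφz) (differentiableAt_of_mem hφ hz)]
    calc ‖(fderiv ℂ f (φ z)).comp (fderiv ℂ φ z)‖ ≤ ‖fderiv ℂ f (φ z)‖ * ‖fderiv ℂ φ z‖ :=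
          ContinuousLinearMap.opNorm_comp_le _ _
      _ ≤ (L * ((1 - ‖φ z‖ ^ 2) / 4) ^ (p - 1)) *
          (n * M * ((1 - ‖φ z‖ ^ 2) ^ (1 - p) * (1 - ‖z‖ ^ 2) ^ (q - 1))) := by
          gcongr
      _ = L * A * (1 - ‖z‖ ^ 2) ^ (q - 1) *
          ((1 - ‖φ z‖ ^ 2) ^ (p - 1) * (1 - ‖φ z‖ ^ 2) ^ (1 - p)) := by
          rw [div_eq_mul_one_div, Real.mul_rpow hb.le (by norm_num), hA]; ring
      _ = L * A * (1 - ‖z‖ ^ 2) ^ (q - 1) := by rw [hcancel, mul_one]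
  obtain ⟨hmem, hlip⟩ := memLip_of_norm_fderiv_le (mul_nonneg hL0 hA0) hq
    (hf.1.comp hφ hmaps) hbound
  refine ⟨hmem, ?_⟩
  have hzero : ‖f (φ 0)‖ ≤ ‖f 0‖ + L := by
    have h1 := hHf _ (hmaps h0) 0 h0
    rw [sub_zero] at h1
    have h2 : ‖φ 0‖ ^ p ≤ 1 :=
      Real.rpow_le_one (norm_nonneg _) (norm_lt_one_of_mem (hmaps h0)).le hp0.le
    have h3 := norm_sub_norm_le (f (φ 0)) (f 0)
    nlinarith
  have hX : 0 ≤ A * (1 + 2 / q) * ‖f 0‖ := by positivity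
  simp only [lipNorm, Function.comp_apply]
  calc ‖f (φ 0)‖ + lipConst q (f ∘ φ) ≤ (‖f 0‖ + L) + L * A * (1 + 2 / q) :=
        add_le_add hzero hlip
    _ ≤ (1 + A * (1 + 2 / q)) * (‖f 0‖ + L) := by linarith

/-! ### Necessity: test functions and part (B) -/

/-- The test functions `w ↦ (1 - c ⟨w, u⟩)^p` with `|c| = |u| = 1`. -/
noncomputable def testFun (p : ℝ) (c : ℂ) (u w : EuclideanSpace ℂ (Fin n)) : ℂ :=
  (1 - c * inner ℂ u w) ^ (p : ℂ)

theorem norm_inner_lt_one {u w : EuclideanSpace ℂ (Fin n)} (hu : ‖u‖ = 1) (hw : w ∈ unitBall n) :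
    ‖inner ℂ u w‖ < 1 := by
  have h := norm_inner_le_norm (𝕜 := ℂ) u w
  rw [hu, one_mul] at h
  exact h.trans_lt (norm_lt_one_of_mem hw)

theorem one_sub_mem_slitPlane {ζ : ℂ} (h : ‖ζ‖ < 1) : 1 - ζ ∈ Complex.slitPlane := by
  left
  have := (Complex.re_le_norm ζ).trans_lt h
  simpa using this

/-- A general ψ covers both the test function (ψ = ⟨·,u⟩) and its composite with φ. -/
theorem hasFDerivAt_one_sub_cpow {p : ℝ} {c : ℂ} (hc : ‖c‖ = 1) {E : Type*}
    [NormedAddCommGroup E] [NormedSpace ℂ E] {ψ : E → ℂ} {w : E} (hψ : DifferentiableAt ℂ ψ w)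
    (hlt : ‖ψ w‖ < 1) :
    HasFDerivAt (fun x => (1 - c * ψ x) ^ (p : ℂ))
      ((-(p * (1 - c * ψ w) ^ ((p : ℂ) - 1) * c)) • fderiv ℂ ψ w) w := by
  have h1 : HasDerivAt (fun ζ : ℂ => (1 - c * ζ) ^ (p : ℂ))
      (-(p * (1 - c * ψ w) ^ ((p : ℂ) - 1) * c)) (ψ w) := by
    have h2 : HasDerivAt (fun ζ : ℂ => 1 - c * ζ) (-c) (ψ w) := by
      simpa using ((hasDerivAt_id (ψ w)).const_mul c).const_sub 1
    convert h2.cpow_const (c := (p : ℂ)) (one_sub_mem_slitPlane (by simpa [hc] using hlt)) using 1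
    ring
  exact h1.comp_hasFDerivAt w hψ.hasFDerivAt

theorem norm_deriv_one_sub_cpow {p : ℝ} (hp : 0 < p) {c : ℂ} (hc : ‖c‖ = 1) {ζ : ℂ}
    (h : ‖ζ‖ < 1) :
    ‖-((p : ℂ) * (1 - c * ζ) ^ ((p : ℂ) - 1) * c)‖ = p * ‖1 - c * ζ‖ ^ (p - 1) := by
  have hne : 1 - c * ζ ≠ 0 :=
    Complex.slitPlane_ne_zero (one_sub_mem_slitPlane (by simpa [hc] using h))
  have : ((p : ℂ) - 1) = ((p - 1 : ℝ) : ℂ) := by push_cast; rfl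
  rw [norm_neg, norm_mul, norm_mul, hc, mul_one, Complex.norm_real, Real.norm_of_nonneg hp.le, this,
    Complex.norm_cpow_real]

/-- The bound is free of c and u because |1 - c⟨w,u⟩| ≥ 1 - |w| ≥ (1 - |w|²)/2. -/
theorem testFun_memLip {p : ℝ} (hp : p ∈ Ioo (0 : ℝ) 1) {c : ℂ} (hc : ‖c‖ = 1)
    {u : EuclideanSpace ℂ (Fin n)} (hu : ‖u‖ = 1) :
    MemLip p (testFun p c u) ∧
      lipNorm p (testFun p c u) ≤ 1 + p * (1 / 2) ^ (p - 1) * (1 + 2 / p) := by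
  obtain ⟨hp0, hp1⟩ := hp
  have hψ : ∀ w, HasFDerivAt (fun x => inner ℂ u x) (innerSL ℂ u) w := fun w =>
    (innerSL ℂ u).hasFDerivAt
  have hF : ∀ w ∈ unitBall n, HasFDerivAt (testFun p c u) _ w := fun w hw =>
    hasFDerivAt_one_sub_cpow (p := p) hc (hψ w).differentiableAt (norm_inner_lt_one hu hw)
  have hb : ∀ w ∈ unitBall n, ‖fderiv ℂ (testFun p c u) w‖ ≤
      p * (1 / 2) ^ (p - 1) * (1 - ‖w‖ ^ 2) ^ (p - 1) := by
    intro w hw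
    have hw1 := norm_lt_one_of_mem hw
    have hpos := one_sub_norm_sq_pos hw1
    rw [(hF w hw).fderiv, norm_smul, norm_deriv_one_sub_cpow hp0 hc (norm_inner_lt_one hu hw),
      (hψ w).fderiv, innerSL_apply_norm, hu, mul_one, mul_assoc]
    refine mul_le_mul_of_nonneg_left ?_ hp0.le
    rw [← Real.mul_rpow (by norm_num) hpos.le]
    refine Real.rpow_le_rpow_of_nonpos (by positivity) ?_ (by linarith)
    have h1 := norm_sub_norm_le (1 : ℂ) (c * inner ℂ u w)
    have h2 := norm_inner_le_norm (𝕜 := ℂ) u w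
    rw [norm_mul, hc, one_mul, norm_one] at h1
    rw [hu, one_mul] at h2
    nlinarith [norm_nonneg w]
  obtain ⟨h1, h2⟩ := memLip_of_norm_fderiv_le (by positivity) ⟨hp0, hp1⟩
    (fun w hw => (hF w hw).differentiableAt.differentiableWithinAt) hb
  refine ⟨h1, ?_⟩
  have h3 : ‖testFun p c u 0‖ = 1 := by simp [testFun]
  rw [lipNorm, h3]
  linarith

theorem grad_inner_le_of_isBoundedComp {p q : ℝ} (hp : p ∈ Ioo (0 : ℝ) 1)
    (hq : q ∈ Ioo (0 : ℝ) 1) {φ : EuclideanSpace ℂ (Fin n) → EuclideanSpace ℂ (Fin n)}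
    (hφ : DifferentiableOn ℂ φ (unitBall n)) (hmaps : MapsTo φ (unitBall n) (unitBall n))
    (h : IsBoundedComp p q φ) :
    ∃ M' : ℝ, 0 ≤ M' ∧ ∀ z ∈ unitBall n,
      ∀ u ∈ sphere (0 : EuclideanSpace ℂ (Fin n)) 1,
        (1 - ‖z‖ ^ 2) ^ (1 - q) / (1 - ‖inner ℂ u (φ z)‖ ^ 2) ^ (1 - p) *
          ‖grad (fun x => inner ℂ u (φ x)) z‖ ≤ M' := by
  obtain ⟨C, hC0, hC⟩ := h
  have hp0 := hp.1
  set L := C * (1 + p * (1 / 2) ^ (p - 1) * (1 + 2 / p)) with hL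
  have hL0 : 0 ≤ L := by positivity
  refine ⟨L * (1 / 4) ^ (q - 1) / p, by positivity, fun z hz u hu => ?_⟩
  have hu1 : ‖u‖ = 1 := mem_sphere_zero_iff_norm.1 hu
  set ζ : ℂ := inner ℂ u (φ z) with hζ
  have hζ1 : ‖ζ‖ < 1 := norm_inner_lt_one hu1 (hmaps hz)
  -- Rotating ζ onto the positive axis minimises |1 - cζ|, with value 1 - |ζ|. Here c depends on z
  -- and u, which the uniform norm bound permits.
  obtain ⟨c, hc, hcζ⟩ : ∃ c : ℂ, ‖c‖ = 1 ∧ c * ζ = ‖ζ‖ := by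
    rcases eq_or_ne ζ 0 with h0 | h0
    · exact ⟨1, by simp, by simp [h0]⟩
    · have hn : (‖ζ‖ : ℂ) ≠ 0 := by simpa using h0
      exact ⟨‖ζ‖ / ζ, by simp [h0], by field_simp⟩
  obtain ⟨hmem, hnorm⟩ := testFun_memLip hp hc hu1
  obtain ⟨hmem', hle⟩ := hC _ hmem
  have hlip : lipConst q (testFun p c u ∘ φ) ≤ L := by
    have h1 : lipConst q (testFun p c u ∘ φ) ≤ lipNorm q (testFun p c u ∘ φ) := by
      rw [lipNorm]; linarith [norm_nonneg ((testFun p c u ∘ φ) 0)]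
    exact h1.trans (hle.trans (mul_le_mul_of_nonneg_left hnorm hC0))
  have hD := norm_fderiv_le_of_holder hL0 hmem'.1
    (fun x hx y hy => (norm_sub_le_lipConst hq.1 hmem' hx hy).trans (by gcongr)) hz
  have hψ : DifferentiableAt ℂ (fun x => inner ℂ u (φ x)) z :=
    (innerSL ℂ u).differentiableAt.comp z (differentiableAt_of_mem hφ hz)
  have hF : HasFDerivAt (testFun p c u ∘ φ) _ z := hasFDerivAt_one_sub_cpow (p := p) hc hψ hζ1
  rw [hF.fderiv, norm_smul, norm_deriv_one_sub_cpow hp0 hc hζ1, ← norm_grad_eq_norm_fderiv hψ,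
    hcζ] at hD
  have ha := one_sub_norm_sq_pos (norm_lt_one_of_mem hz)
  have hb := one_sub_norm_sq_pos hζ1
  have hb1 : 0 < 1 - ‖ζ‖ := by linarith
  have hn : ‖(1 : ℂ) - ‖ζ‖‖ = 1 - ‖ζ‖ := by
    rw [← Complex.ofReal_one, ← Complex.ofReal_sub, Complex.norm_real, Real.norm_of_nonneg hb1.le]
  rw [hn, div_eq_mul_one_div, Real.mul_rpow ha.le (by norm_num)] at hD
  have hmono : (1 - ‖ζ‖ ^ 2) ^ (p - 1) ≤ (1 - ‖ζ‖) ^ (p - 1) :=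
    Real.rpow_le_rpow_of_nonpos hb1 (by nlinarith [norm_nonneg ζ]) (by linarith [hp.2])
  have ea : (1 - ‖z‖ ^ 2) ^ (1 - q) * (1 - ‖z‖ ^ 2) ^ (q - 1) = 1 := by
    rw [← Real.rpow_add ha]; simp
  have eb : ((1 - ‖ζ‖ ^ 2) ^ (1 - p))⁻¹ = (1 - ‖ζ‖ ^ 2) ^ (p - 1) := by
    rw [← Real.rpow_neg hb.le, neg_sub]
  set G := ‖grad (fun x => inner ℂ u (φ x)) z‖ with hG
  have hG0 : 0 ≤ G := norm_nonneg _
  rw [div_eq_mul_inv, eb, le_div_iff₀ hp0]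
  calc (1 - ‖z‖ ^ 2) ^ (1 - q) * (1 - ‖ζ‖ ^ 2) ^ (p - 1) * G * p
      ≤ (1 - ‖z‖ ^ 2) ^ (1 - q) * (1 - ‖ζ‖) ^ (p - 1) * G * p := by gcongr
    _ = (1 - ‖z‖ ^ 2) ^ (1 - q) * (p * (1 - ‖ζ‖) ^ (p - 1) * G) := by ring
    _ ≤ (1 - ‖z‖ ^ 2) ^ (1 - q) *
        (L * ((1 - ‖z‖ ^ 2) ^ (q - 1) * (1 / 4) ^ (q - 1))) := by gcongr
    _ = (1 - ‖z‖ ^ 2) ^ (1 - q) * (1 - ‖z‖ ^ 2) ^ (q - 1) * (L * (1 / 4) ^ (q - 1)) := by ring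
    _ = L * (1 / 4) ^ (q - 1) := by rw [ea, one_mul]

end LipschitzBall


/- `inner ℂ u (φ z)` is `∑ k, φ_k(z) * conj u_k`. -/
theorem corollary2p2 (n : ℕ) (p q : ℝ) (hp : p ∈ Set.Ioo (0 : ℝ) 1) (hq : q ∈ Set.Ioo (0 : ℝ) 1)
    (φ : EuclideanSpace ℂ (Fin n) → EuclideanSpace ℂ (Fin n))
    (hφ : DifferentiableOn ℂ φ (LipschitzBall.unitBall n))
    (hmaps : Set.MapsTo φ (LipschitzBall.unitBall n) (LipschitzBall.unitBall n)) :
    ((∃ M : ℝ, 0 ≤ M ∧ ∀ j : Fin n, ∀ z ∈ LipschitzBall.unitBall n,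
        (1 - ‖z‖ ^ 2) ^ (1 - q) / (1 - ‖φ z‖ ^ 2) ^ (1 - p) *
          ‖LipschitzBall.grad (fun x => φ x j) z‖ ≤ M) →
      LipschitzBall.IsBoundedComp p q φ) ∧
    (LipschitzBall.IsBoundedComp p q φ →
      ∃ M' : ℝ, 0 ≤ M' ∧ ∀ z ∈ LipschitzBall.unitBall n,
        ∀ u ∈ Metric.sphere (0 : EuclideanSpace ℂ (Fin n)) 1,
          (1 - ‖z‖ ^ 2) ^ (1 - q) / (1 - ‖inner ℂ u (φ z)‖ ^ 2) ^ (1 - p) *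
            ‖LipschitzBall.grad (fun x => inner ℂ u (φ x)) z‖ ≤ M') := by
  exact ⟨fun ⟨_, hM, h⟩ => LipschitzBall.isBoundedComp_of_grad_le hp hq hφ hmaps hM h,
    LipschitzBall.grad_inner_le_of_isBoundedComp hp hq hφ hmaps⟩
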